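/- For an integer $k\ge 4$ let $\mathcal S_k$ be the graph with vertex set $\{1,\dots,2k-1\}$ and the following edges. If $k$ is even: undirected edges $(4i-2,4i-1)$, $(4i-1,4i)$, $(4i,4i+1)$ for $i=1,\dots,\frac{k-2}{2}$; directed edges $(4i-2,4i+5)$ and $(4i+1,4i+2)$ for $i=1,\dots,\frac{k-4}{2}$; and directed edges $(1,2)$, $(2k-6,2k-1)$, $(2k-3,2k-2)$, $(2k-2,1)$, $(2k-2,5)$, $(2k-1,2k-2)$. If $k$ is odd: undirected edges $(4i-2,4i-1)$, $(4i-1,4i)$, $(4i,4i+1)$ for $i=1,\dots,\frac{k-1}{2}$; directed edges $(4i-2,4i+5)$ and $(4i+1,4i+2)$ for $i=1,\dots,\frac{k-3}{2}$; and directed edges $(1,2)$, $(2k-4,1)$, $(2k-2,5)$. Then, forgetting the orientations of the edges (and identifying parallel edges), $\mathcal S_k$ is planar whenever $k\not\equiv 1\pmod 4$. If $k\equiv 1\pmod 4$, then $\mathcal S_k$ has a drawing in the plane with exactly one crossing. Here in a drawing the vertices are distinct points, the edges are simple arcs that pass through no vertices other than their endpoints, the interiors of any two edges meet in finitely many points and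 cross at each of them, and no point is interior to three edges; a graph is planar if it has a drawing without crossings. -/

import Mathlib

namespace InOutGraph

/-! ### The digraphs `S_k`, `k ≥ 4` -/

/-- `(a, b)` is one of the two orientations of the undirected edge `{x, y}`. -/
def EitherWay (a b x y : ℕ) : Prop := (a = x ∧ b = y) ∨ (a = y ∧ b = x)

/-- The pair `(a, b)` is one of the directed edges in the construction of `S_k` for even `k ≥ 4`;
an undirected edge counts as two opposite directed edges. -/
def EvenEdge (k a b : ℕ) : Prop :=
  (∃ i ∈ Finset.Icc 1 ((k - 2) / 2),
    EitherWay a b (4 * i - 2) (4 * i - 1) ∨ EitherWay a b (4 * i - 1) (4 * i) ∨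
      EitherWay a b (4 * i) (4 * i + 1)) ∨
  (∃ i ∈ Finset.Icc 1 ((k - 4) / 2),
    (a = 4 * i - 2 ∧ b = 4 * i + 5) ∨ (a = 4 * i + 1 ∧ b = 4 * i + 2)) ∨
  (a = 1 ∧ b = 2) ∨ (a = 2 * k - 6 ∧ b = 2 * k - 1) ∨ (a = 2 * k - 3 ∧ b = 2 * k - 2) ∨
  (a = 2 * k - 2 ∧ b = 1) ∨ (a = 2 * k - 2 ∧ b = 5) ∨ (a = 2 * k - 1 ∧ b = 2 * k - 2)

/-- The pair `(a, b)` is one of the directed edges in the construction of `S_k` for odd `k ≥ 5`;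
an undirected edge counts as two opposite directed edges. -/
def OddEdge (k a b : ℕ) : Prop :=
  (∃ i ∈ Finset.Icc 1 ((k - 1) / 2),
    EitherWay a b (4 * i - 2) (4 * i - 1) ∨ EitherWay a b (4 * i - 1) (4 * i) ∨
      EitherWay a b (4 * i) (4 * i + 1)) ∨
  (∃ i ∈ Finset.Icc 1 ((k - 3) / 2),
    (a = 4 * i - 2 ∧ b = 4 * i + 5) ∨ (a = 4 * i + 1 ∧ b = 4 * i + 2)) ∨
  (a = 1 ∧ b = 2) ∨ (a = 2 * k - 4 ∧ b = 1) ∨ (a = 2 * k - 2 ∧ b = 5)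

/-- The digraph `S_k` on the vertex set `{1, …, 2k - 1}` (meant for `k ≥ 4`). -/
def S (k : ℕ) : Digraph (Finset.Icc 1 (2 * k - 1)) where
  Adj a b := (Even k ∧ EvenEdge k a b) ∨ (Odd k ∧ OddEdge k a b)

/-! ### Drawings of graphs in the plane -/

/-- `A` is a simple arc with endpoints `x` and `y`. -/
def IsSimpleArc (x y : ℝ × ℝ) (A : Set (ℝ × ℝ)) : Prop :=
  ∃ γ : Path x y, Function.Injective γ ∧ Set.range γ = A

/-- The sets `A` and `B` cross each other at the point `p`: some homeomorphism from an open
neighbourhood of `p` onto an open neighbourhood of the origin takes `p` to the origin,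
`A` to the horizontal axis and `B` to the vertical axis. -/
def CrossAt (A B : Set (ℝ × ℝ)) (p : ℝ × ℝ) : Prop :=
  ∃ φ : OpenPartialHomeomorph (ℝ × ℝ) (ℝ × ℝ), p ∈ φ.source ∧ φ p = 0 ∧
    ∀ q ∈ φ.source, (q ∈ A ↔ (φ q).2 = 0) ∧ (q ∈ B ↔ (φ q).1 = 0)

/-- A drawing of a graph in the plane: vertices are distinct points, every edge is a simple arc
between its endpoints that passes through no other vertex, the interiors of two distinct edges
have only finitely many points in common and cross each other at each of them, and no point is
interior to three distinct edges. -/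
structure Drawing {V : Type*} (G : SimpleGraph V) where
  /-- the position of a vertex -/
  pos : V → ℝ × ℝ
  /-- the arc that represents an edge -/
  arc : G.edgeSet → Set (ℝ × ℝ)
  pos_injective : Function.Injective pos
  isSimpleArc : ∀ (u v : V) (h : G.Adj u v), IsSimpleArc (pos u) (pos v) (arc ⟨s(u, v), h⟩)
  mem_of_pos_mem : ∀ (e : G.edgeSet) (w : V), pos w ∈ arc e → w ∈ (e : Sym2 V)
  finite_inter : ∀ e f : G.edgeSet, e ≠ f →
    ((arc e \ Set.range pos) ∩ (arc f \ Set.range pos)).Finite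
  crossAt : ∀ e f : G.edgeSet, e ≠ f →
    ∀ p ∈ (arc e \ Set.range pos) ∩ (arc f \ Set.range pos), CrossAt (arc e) (arc f) p
  no_triple : ∀ e f g : G.edgeSet, e ≠ f → e ≠ g → f ≠ g →
    (arc e \ Set.range pos) ∩ (arc f \ Set.range pos) ∩ (arc g \ Set.range pos) = ∅

/-- The crossings of a drawing: the points that are interior to two distinct edges. -/
def Drawing.crossings {V : Type*} {G : SimpleGraph V} (D : Drawing G) : Set (ℝ × ℝ) :=
  {p | ∃ e f : G.edgeSet, e ≠ f ∧
    p ∈ (D.arc e \ Set.range D.pos) ∩ (D.arc f \ Set.range D.pos)}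

/-- A graph is planar if it has a drawing in the plane without crossings. -/
def IsPlanar {V : Type*} (G : SimpleGraph V) : Prop :=
  ∃ D : Drawing G, D.crossings = ∅

end InOutGraph

/-!
Forget the orientations and cut the vertices `2, …, 4 m + 1`, where `k = 2 m + 1` or `k = 2 m + 2`,
into the `m` blocks `4 i - 2, …, 4 i + 1`. Every block is a path of three edges, and the edges
`(4 i + 1, 4 i + 2)` and `(4 i - 2, 4 i + 5)` join the ends of consecutive blocks crosswise. So the
blocks are the rungs of a ladder whose rails alternate between first and last vertices of blocks.
The ladder is drawn with straight segments, the `i`-th rung on the line `x = i`, traversed downwards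
and upwards alternately, and the rails on `y = 0` and `y = 3`.

For `k = 2 m + 1` there remain a path from `2` over `1` to the first vertex of the last block, and
an edge from `5` to the third vertex of the last block. If the last rung is drawn with its first
vertex on top, the path fits above the ladder and the edge fits below it, with the third vertex of
the last rung pulled out below the fourth. For odd `m` the last rung has this direction anyway. For
even `m` it has to be reversed, and then the two links between the last two rungs become the
diagonals of a rectangle, which is the one crossing.

For `k = 2 m + 2` there remains a hub `2 k - 2`, joined to `5`, over `1` to `2`, to the last vertex
of the last block, and over `2 k - 1` to its first vertex. These are the four corners of the ladder,
so the hub fits outside the ladder. Here the rungs are directed so that the last one goes downwards;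
the parity of `m` decides which of `2` and `5` is the upper left corner.

That the segments do not meet elsewhere is linear arithmetic: `OddSegment` and `EvenSegment` list
the segments with integer coordinates, and `OddSegment.apart` and `EvenSegment.apart` show that any
two of them, up to the crossing pair, are weakly separated by a line that is vertical, horizontal
or of slope `-1` and contains at most one of them. Such segments meet in endpoints only
(`Apart.mem_endpoints`).
-/

namespace InOutGraph

/-! ### Straight-line drawings -/

/-- Two segments that are weakly separated by a linear form `f`, not both in the same level set of
`f`, meet at most in endpoints. -/
theorem mem_endpoints_of_mem_segments {p q r s z : ℝ × ℝ} (f : ℝ × ℝ →ₗ[ℝ] ℝ)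
    (hpr : f p ≤ f r) (hps : f p ≤ f s) (hqr : f q ≤ f r) (hqs : f q ≤ f s)
    (hlt : f p + f q < f r + f s) (hz : z ∈ segment ℝ p q) (hz' : z ∈ segment ℝ r s) :
    z = p ∨ z = q ∨ z = r ∨ z = s := by
  obtain ⟨a, b, ha, hb, hab, rfl⟩ := hz
  obtain ⟨c, d, hc, hd, hcd, h⟩ := hz'
  rcases ha.eq_or_lt with rfl | ha
  · obtain rfl : b = 1 := by linarith
    simp
  rcases hb.eq_or_lt with rfl | hb
  · obtain rfl : a = 1 := by linarith
    simp
  rcases hc.eq_or_lt with rfl | hc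
  · obtain rfl : d = 1 := by linarith
    simp [← h]
  rcases hd.eq_or_lt with rfl | hd
  · obtain rfl : c = 1 := by linarith
    simp [← h]
  exfalso
  have hf := congrArg f h
  simp only [map_add, map_smul, smul_eq_mul] at hf
  obtain rfl : b = 1 - a := by linarith
  obtain rfl : d = 1 - c := by linarith
  -- The difference of the two values of `f` is a combination of the four nonnegative differences
  -- with positive coefficients.
  have hsum : a * c * (f r - f p) + a * (1 - c) * (f s - f p) + (1 - a) * c * (f r - f q)
      + (1 - a) * (1 - c) * (f s - f q) = 0 := by
    linear_combination hf
  have h1 := mul_nonneg (mul_pos ha hc).le (sub_nonneg.2 hpr)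
  have h2 := mul_nonneg (mul_pos ha hd).le (sub_nonneg.2 hps)
  have h3 := mul_nonneg (mul_pos hb hc).le (sub_nonneg.2 hqr)
  have h4 := mul_nonneg (mul_pos hb hd).le (sub_nonneg.2 hqs)
  have e1 : f r - f p = 0 := by
    have : a * c * (f r - f p) = 0 := by linarith
    exact (mul_eq_zero.1 this).resolve_left (mul_pos ha hc).ne'
  have e4 : f s - f q = 0 := by
    have : (1 - a) * (1 - c) * (f s - f q) = 0 := by linarith
    exact (mul_eq_zero.1 this).resolve_left (mul_pos hb hd).ne'
  linarith

theorem eq_endpoint_of_mem_segment {p q w : ℝ × ℝ} (f : ℝ × ℝ →ₗ[ℝ] ℝ)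
    (hp : f p ≤ f w) (hq : f q ≤ f w) (hlt : f p + f q < f w + f w) (hw : w ∈ segment ℝ p q) :
    w = p ∨ w = q := by
  obtain ⟨a, b, ha, hb, hab, h⟩ := hw
  rcases ha.eq_or_lt with rfl | ha
  · obtain rfl : b = 1 := by linarith
    simp [← h]
  rcases hb.eq_or_lt with rfl | hb
  · obtain rfl : a = 1 := by linarith
    simp [← h]
  exfalso
  have hf := congrArg f h
  simp only [map_add, map_smul, smul_eq_mul] at hf
  obtain rfl : b = 1 - a := by linarith
  have hsum : a * (f w - f p) + (1 - a) * (f w - f q) = 0 := by linear_combination -hf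
  have h1 := mul_nonneg ha.le (sub_nonneg.2 hp)
  have h2 := mul_nonneg hb.le (sub_nonneg.2 hq)
  have e1 := (mul_eq_zero.1 (show a * (f w - f p) = 0 by linarith)).resolve_left ha.ne'
  have e2 := (mul_eq_zero.1 (show (1 - a) * (f w - f q) = 0 by linarith)).resolve_left hb.ne'
  linarith

/-- The interval spanned by `a` and `b` lies weakly below the one spanned by `c` and `d`, and the
two intervals are not the same single point. -/
def Below (a b c d : ℤ) : Prop := a ≤ c ∧ a ≤ d ∧ b ≤ c ∧ b ≤ d ∧ a + b < c + d

/-- The segments from `(x₁, y₁)` to `(x₂, y₂)` and from `(x₃, y₃)` to `(x₄, y₄)` are weakly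
separated by a line that is vertical, horizontal or of slope `-1` and that does not contain both
segments. -/
def Apart (x₁ y₁ x₂ y₂ x₃ y₃ x₄ y₄ : ℤ) : Prop :=
  Below x₁ x₂ x₃ x₄ ∨ Below x₃ x₄ x₁ x₂ ∨ Below y₁ y₂ y₃ y₄ ∨ Below y₃ y₄ y₁ y₂ ∨
    Below (x₁ + y₁) (x₂ + y₂) (x₃ + y₃) (x₄ + y₄) ∨ Below (x₃ + y₃) (x₄ + y₄) (x₁ + y₁) (x₂ + y₂)

/-- The point of the plane with the given integer coordinates. -/
def pt (x y : ℤ) : ℝ × ℝ := (x, y)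

theorem pt_inj {x y x' y' : ℤ} : pt x y = pt x' y' ↔ x = x' ∧ y = y' := by
  simp [pt]

theorem Below.cast {a b c d : ℤ} (h : Below a b c d) :
    (a : ℝ) ≤ c ∧ (a : ℝ) ≤ d ∧ (b : ℝ) ≤ c ∧ (b : ℝ) ≤ d ∧ (a : ℝ) + b < c + d := by
  obtain ⟨h1, h2, h3, h4, h5⟩ := h
  exact ⟨mod_cast h1, mod_cast h2, mod_cast h3, mod_cast h4, mod_cast h5⟩

theorem Apart.mem_endpoints {x₁ y₁ x₂ y₂ x₃ y₃ x₄ y₄ : ℤ} (h : Apart x₁ y₁ x₂ y₂ x₃ y₃ x₄ y₄)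
    {z : ℝ × ℝ} (hz : z ∈ segment ℝ (pt x₁ y₁) (pt x₂ y₂))
    (hz' : z ∈ segment ℝ (pt x₃ y₃) (pt x₄ y₄)) :
    z = pt x₁ y₁ ∨ z = pt x₂ y₂ ∨ z = pt x₃ y₃ ∨ z = pt x₄ y₄ := by
  rcases h with h | h | h | h | h | h <;> obtain ⟨h1, h2, h3, h4, h5⟩ := h.cast <;>
    push_cast at h1 h2 h3 h4 h5
  · exact mem_endpoints_of_mem_segments (LinearMap.fst ℝ ℝ ℝ) h1 h2 h3 h4 h5 hz hz'
  · have := mem_endpoints_of_mem_segments (LinearMap.fst ℝ ℝ ℝ) h1 h2 h3 h4 h5 hz' hz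
    tauto
  · exact mem_endpoints_of_mem_segments (LinearMap.snd ℝ ℝ ℝ) h1 h2 h3 h4 h5 hz hz'
  · have := mem_endpoints_of_mem_segments (LinearMap.snd ℝ ℝ ℝ) h1 h2 h3 h4 h5 hz' hz
    tauto
  · exact mem_endpoints_of_mem_segments (LinearMap.fst ℝ ℝ ℝ + LinearMap.snd ℝ ℝ ℝ) h1 h2 h3 h4 h5
      hz hz'
  · have := mem_endpoints_of_mem_segments (LinearMap.fst ℝ ℝ ℝ + LinearMap.snd ℝ ℝ ℝ) h1 h2 h3 h4 h5
      hz' hz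
    tauto

/-- If the separation holds between a segment and a degenerate segment, the point of the latter can
lie on the former only as an endpoint. -/
theorem Apart.eq_endpoint {x₁ y₁ x₂ y₂ x y : ℤ} (h : Apart x₁ y₁ x₂ y₂ x y x y)
    (hw : pt x y ∈ segment ℝ (pt x₁ y₁) (pt x₂ y₂)) :
    pt x y = pt x₁ y₁ ∨ pt x y = pt x₂ y₂ := by
  rcases h with h | h | h | h | h | h <;> obtain ⟨h1, h2, h3, h4, h5⟩ := h.cast <;>
    push_cast at h1 h2 h3 h4 h5
  · exact eq_endpoint_of_mem_segment (LinearMap.fst ℝ ℝ ℝ) h1 h3 h5 hw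
  · refine eq_endpoint_of_mem_segment (-LinearMap.fst ℝ ℝ ℝ) ?_ ?_ ?_ hw <;>
      simp only [LinearMap.neg_apply, LinearMap.fst_apply, pt] <;> linarith
  · exact eq_endpoint_of_mem_segment (LinearMap.snd ℝ ℝ ℝ) h1 h3 h5 hw
  · refine eq_endpoint_of_mem_segment (-LinearMap.snd ℝ ℝ ℝ) ?_ ?_ ?_ hw <;>
      simp only [LinearMap.neg_apply, LinearMap.snd_apply, pt] <;> linarith
  · exact eq_endpoint_of_mem_segment (LinearMap.fst ℝ ℝ ℝ + LinearMap.snd ℝ ℝ ℝ) h1 h3 h5 hw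
  · refine eq_endpoint_of_mem_segment (-(LinearMap.fst ℝ ℝ ℝ + LinearMap.snd ℝ ℝ ℝ)) ?_ ?_ ?_ hw <;>
      simp only [LinearMap.neg_apply, LinearMap.add_apply, LinearMap.fst_apply,
        LinearMap.snd_apply, pt] <;> linarith

/-- The straight segment that represents an edge. -/
def edgeSegment {V : Type*} (pos : V → ℝ × ℝ) (e : Sym2 V) : Set (ℝ × ℝ) :=
  Sym2.lift ⟨fun u v => segment ℝ (pos u) (pos v), fun _ _ => segment_symm ..⟩ e

@[simp]
theorem edgeSegment_mk {V : Type*} (pos : V → ℝ × ℝ) (u v : V) :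
    edgeSegment pos s(u, v) = segment ℝ (pos u) (pos v) := rfl

/-- A straight-line drawing, from the positions of its vertices. -/
def straightLineDrawing {V : Type*} {G : SimpleGraph V} (pos : V → ℝ × ℝ)
    (hpos : Function.Injective pos)
    (hmem : ∀ u v w, G.Adj u v → pos w ∈ segment ℝ (pos u) (pos v) → w = u ∨ w = v)
    (hfin : ∀ e f : G.edgeSet, e ≠ f →
      ((edgeSegment pos e \ Set.range pos) ∩ (edgeSegment pos f \ Set.range pos)).Finite)
    (hcross : ∀ e f : G.edgeSet, e ≠ f →
      ∀ p ∈ (edgeSegment pos e \ Set.range pos) ∩ (edgeSegment pos f \ Set.range pos),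
        CrossAt (edgeSegment pos e) (edgeSegment pos f) p)
    (htriple : ∀ e f g : G.edgeSet, e ≠ f → e ≠ g → f ≠ g →
      (edgeSegment pos e \ Set.range pos) ∩ (edgeSegment pos f \ Set.range pos) ∩
        (edgeSegment pos g \ Set.range pos) = ∅) :
    Drawing G where
  pos := pos
  arc e := edgeSegment pos e
  pos_injective := hpos
  isSimpleArc u v h := ⟨Path.segment (pos u) (pos v),
    Path.segment_injective_of_ne (hpos.ne h.ne), Path.range_segment _ _⟩
  mem_of_pos_mem := by
    rintro ⟨e, he⟩ w hw
    induction e with | _ u v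
    simpa using hmem u v w he hw
  finite_inter := hfin
  crossAt := hcross
  no_triple := htriple

theorem CrossAt.symm {A B : Set (ℝ × ℝ)} {p : ℝ × ℝ} (h : CrossAt A B p) : CrossAt B A p := by
  obtain ⟨φ, hp, h0, h⟩ := h
  refine ⟨φ.transHomeomorph (Homeomorph.prodComm ℝ ℝ), hp, ?_, fun q hq => ?_⟩
  · simp [h0]
  · exact (h q hq).symm

/-- A straight-line drawing is planar if the interiors of its edges are pairwise disjoint. -/
theorem isPlanar_of_disjoint {V : Type*} {G : SimpleGraph V} (pos : V → ℝ × ℝ)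
    (hpos : Function.Injective pos)
    (hmem : ∀ u v w, G.Adj u v → pos w ∈ segment ℝ (pos u) (pos v) → w = u ∨ w = v)
    (hdisj : ∀ e f : G.edgeSet, e ≠ f →
      (edgeSegment pos e \ Set.range pos) ∩ (edgeSegment pos f \ Set.range pos) = ∅) :
    IsPlanar G := by
  refine ⟨straightLineDrawing pos hpos hmem (fun e f hef => ?_) (fun e f hef => ?_)
    (fun e f g hef _ _ => ?_), ?_⟩
  · simp [hdisj e f hef]
  · simp [hdisj e f hef]
  · simp [hdisj e f hef]
  · refine Set.eq_empty_of_forall_notMem fun p ⟨e, f, hef, hp⟩ => ?_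
    exact (hdisj e f hef).subset hp

/-- A straight-line drawing in which only the edges `e₀` and `f₀` meet in interior points, and that
in one point only, has one crossing. -/
theorem exists_drawing_encard_crossings_eq_one {V : Type*} {G : SimpleGraph V} (pos : V → ℝ × ℝ)
    (hpos : Function.Injective pos)
    (hmem : ∀ u v w, G.Adj u v → pos w ∈ segment ℝ (pos u) (pos v) → w = u ∨ w = v)
    {e₀ f₀ : G.edgeSet} (hne : e₀ ≠ f₀) {p₀ : ℝ × ℝ}
    (hdisj : ∀ e f : G.edgeSet, e ≠ f → (e = e₀ ∧ f = f₀) ∨ (e = f₀ ∧ f = e₀) ∨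
      (edgeSegment pos e \ Set.range pos) ∩ (edgeSegment pos f \ Set.range pos) = ∅)
    (hinter : (edgeSegment pos e₀ \ Set.range pos) ∩ (edgeSegment pos f₀ \ Set.range pos) = {p₀})
    (hcross : CrossAt (edgeSegment pos e₀) (edgeSegment pos f₀) p₀) :
    ∃ D : Drawing G, D.crossings.encard = 1 := by
  have hinter' := Set.inter_comm _ _ ▸ hinter
  refine ⟨straightLineDrawing pos hpos hmem (fun e f hef => ?_) (fun e f hef p hp => ?_)
    (fun e f g hef heg hfg => ?_), Set.encard_eq_one.2 ⟨p₀, ?_⟩⟩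
  · rcases hdisj e f hef with ⟨rfl, rfl⟩ | ⟨rfl, rfl⟩ | h
    · simp [hinter]
    · simp [hinter']
    · simp [h]
  · rcases hdisj e f hef with ⟨rfl, rfl⟩ | ⟨rfl, rfl⟩ | h
    · obtain rfl := hinter.subset hp
      exact hcross
    · obtain rfl := hinter'.subset hp
      exact hcross.symm
    · exact absurd hp (by simp [h])
  · -- Of three distinct edges, one is neither `e₀` nor `f₀`.
    refine Set.eq_empty_of_forall_notMem fun p ⟨⟨he, hf⟩, hg⟩ => ?_
    rcases hdisj e g heg with ⟨rfl, rfl⟩ | ⟨rfl, rfl⟩ | h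
    · rcases hdisj e f hef with ⟨-, rfl⟩ | ⟨h, -⟩ | h
      · exact hfg rfl
      · exact hne h
      · exact h.subset ⟨he, hf⟩
    · rcases hdisj e f hef with ⟨h, -⟩ | ⟨-, rfl⟩ | h
      · exact hne h.symm
      · exact hfg rfl
      · exact h.subset ⟨he, hf⟩
    · exact h.subset ⟨he, hg⟩
  · refine Set.Subset.antisymm (fun p ⟨e, f, hef, hp⟩ => ?_) ?_
    · rcases hdisj e f hef with ⟨rfl, rfl⟩ | ⟨rfl, rfl⟩ | h
      · exact hinter.subset hp
      · exact hinter'.subset hp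
      · exact (h.subset hp).elim
    · rintro _ rfl
      exact ⟨e₀, f₀, hne, hinter.symm.subset rfl⟩

theorem exists_eq_of_mem_segment {V : Type*} {G : SimpleGraph V} {X Y : V → ℤ}
    (hinj : Function.Injective fun v => pt (X v) (Y v))
    (hG : ∀ e ∈ G.edgeSet, ∃ u v, e = s(u, v) ∧
      ∀ w, Apart (X u) (Y u) (X v) (Y v) (X w) (Y w) (X w) (Y w))
    (u v w : V) (huv : G.Adj u v)
    (hw : pt (X w) (Y w) ∈ segment ℝ (pt (X u) (Y u)) (pt (X v) (Y v))) : w = u ∨ w = v := by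
  obtain ⟨u', v', he, h⟩ := hG s(u, v) huv
  rcases Sym2.eq_iff.1 he with ⟨rfl, rfl⟩ | ⟨rfl, rfl⟩
  · exact ((h w).eq_endpoint hw).imp (fun h => hinj h) (fun h => hinj h)
  · rw [segment_symm] at hw
    exact (((h w).eq_endpoint hw).imp (fun h => hinj h) (fun h => hinj h)).symm

theorem inter_eq_empty_of_apart {V : Type*} {X Y : V → ℤ} {u v u' v' : V}
    (h : Apart (X u) (Y u) (X v) (Y v) (X u') (Y u') (X v') (Y v')) :
    (edgeSegment (fun v => pt (X v) (Y v)) s(u, v) \ Set.range fun v => pt (X v) (Y v)) ∩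
      (edgeSegment (fun v => pt (X v) (Y v)) s(u', v') \
        Set.range fun v => pt (X v) (Y v)) = ∅ := by
  refine Set.eq_empty_of_forall_notMem fun z ⟨⟨hz, hn⟩, hz', _⟩ => hn ?_
  rcases h.mem_endpoints hz hz' with rfl | rfl | rfl | rfl <;> exact Set.mem_range_self _

/-! ### A pair of crossing diagonals -/

/-- A segment over the interval `[c, c + 1]` is the graph of an affine function. -/
theorem mem_segment_add_one {c y y' : ℝ} {q : ℝ × ℝ} :
    q ∈ segment ℝ (c, y) (c + 1, y') ↔
      c ≤ q.1 ∧ q.1 ≤ c + 1 ∧ q.2 = y + (y' - y) * (q.1 - c) := by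
  constructor
  · rintro ⟨a, b, ha, hb, hab, rfl⟩
    obtain rfl : a = 1 - b := by linarith
    simp only [Prod.smul_mk, Prod.mk_add_mk, smul_eq_mul]
    exact ⟨by linarith, by linarith, by ring⟩
  · rintro ⟨h1, h2, h3⟩
    refine ⟨c + 1 - q.1, q.1 - c, by linarith, by linarith, by ring, Prod.ext ?_ ?_⟩
    · simp only [Prod.smul_mk, Prod.mk_add_mk, smul_eq_mul]
      ring
    · simp only [Prod.smul_mk, Prod.mk_add_mk, smul_eq_mul, h3]
      ring

/-- The affine change of coordinates that takes the lines through the diagonals of the rectangle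
`[c, c + 1] × [0, 3]` to the coordinate axes. -/
noncomputable def diagonalHomeomorph (c : ℝ) : (ℝ × ℝ) ≃ₜ (ℝ × ℝ) where
  toFun q := (q.2 - 3 + 3 * (q.1 - c), q.2 - 3 * (q.1 - c))
  invFun q := (c + (q.1 - q.2 + 3) / 6, (q.1 + q.2 + 3) / 2)
  left_inv q := Prod.ext (by simp only; ring) (by simp only; ring)
  right_inv q := Prod.ext (by simp only; ring) (by simp only; ring)
  continuous_toFun := by fun_prop
  continuous_invFun := by fun_prop

theorem crossAt_diagonals (c : ℝ) :
    CrossAt (segment ℝ (c, 0) (c + 1, 3)) (segment ℝ (c, 3) (c + 1, 0)) (c + 1 / 2, 3 / 2) := by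
  refine ⟨(diagonalHomeomorph c).toOpenPartialHomeomorph.restrOpen {q | c < q.1 ∧ q.1 < c + 1}
    ((isOpen_lt continuous_const continuous_fst).inter
      (isOpen_lt continuous_fst continuous_const)), ?_, ?_, ?_⟩
  · exact ⟨trivial, by simp, by norm_num⟩
  · change ((3 / 2 - 3 + 3 * (c + 1 / 2 - c), 3 / 2 - 3 * (c + 1 / 2 - c)) : ℝ × ℝ) = 0
    exact Prod.ext (by simp only [Prod.fst_zero]; ring) (by simp only [Prod.snd_zero]; ring)
  · rintro q ⟨-, h1, h2⟩
    change (_ ↔ q.2 - 3 * (q.1 - c) = 0) ∧ (_ ↔ q.2 - 3 + 3 * (q.1 - c) = 0)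
    simp only [mem_segment_add_one, h1.le, h2.le, true_and]
    exact ⟨⟨fun h => by linarith, fun h => by linarith⟩,
      ⟨fun h => by linarith, fun h => by linarith⟩⟩

theorem eq_of_mem_diagonals {c : ℝ} {q : ℝ × ℝ} (h : q ∈ segment ℝ (c, 0) (c + 1, 3))
    (h' : q ∈ segment ℝ (c, 3) (c + 1, 0)) : q = (c + 1 / 2, 3 / 2) := by
  obtain ⟨-, -, h⟩ := mem_segment_add_one.1 h
  obtain ⟨-, -, h'⟩ := mem_segment_add_one.1 h'
  exact Prod.ext (by simp only; linarith) (by simp only; linarith)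

theorem center_mem_diagonals (c : ℝ) :
    (c + 1 / 2, 3 / 2) ∈ segment ℝ (c, 0) (c + 1, 3) ∩ segment ℝ (c, 3) (c + 1, (0 : ℝ)) := by
  constructor <;> refine mem_segment_add_one.2 ⟨?_, ?_, ?_⟩ <;> simp only <;> linarith

/-! ### The drawing for odd `k` -/

/-- The segments of the drawing of `S (2 * m + 1)`, from `(x, y)` to `(x', y')`, each listed in one
direction: the rungs and the rails of the first `m - 1` columns, the edges at the apex `1`, the edge
from `5` that passes below the ladder, the three edges of the last rung, and the two links between
the last two rungs, which are parallel for odd `m` and cross for even `m`. -/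
inductive OddSegment (m x y x' y' : ℤ) : Prop
  | rung (hx : x' = x) (hy : y' = y + 1) (h1 : 1 ≤ x) (h2 : x < m) (h3 : 0 ≤ y) (h4 : y < 3)
  | topRail (hx : x' = x + 1) (hy : y = 3) (hy' : y' = 3) (h1 : 1 ≤ x) (h2 : x + 1 < m)
  | bottomRail (hx : x' = x + 1) (hy : y = 0) (hy' : y' = 0) (h1 : 1 ≤ x) (h2 : x + 1 < m)
  | apexLeft (hx : x = 1) (hy : y = 4) (hx' : x' = 1) (hy' : y' = 3)
  | apexRight (hx : x = 1) (hy : y = 4) (hx' : x' = m) (hy' : y' = 3)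
  | bottom (hx : x = 1) (hy : y = 0) (hx' : x' = m) (hy' : y' = -1)
  | lastOne (hx : x = m) (hy : y = 3) (hx' : x' = m + 1) (hy' : y' = 1)
  | lastTwo (hx : x = m + 1) (hy : y = 1) (hx' : x' = m) (hy' : y' = -1)
  | lastThree (hx : x = m) (hy : y = -1) (hx' : x' = m) (hy' : y' = 0)
  | topLink (hx : x = m - 1) (hx' : x' = m) (hy : y = 3) (hy' : y' = 3) (hm : m % 2 = 1)
  | bottomLink (hx : x = m - 1) (hx' : x' = m) (hy : y = 0) (hy' : y' = 0) (hm : m % 2 = 1)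
  | downLink (hx : x = m - 1) (hx' : x' = m) (hy : y = 3) (hy' : y' = 0) (hm : m % 2 = 0)
  | upLink (hx : x = m - 1) (hx' : x' = m) (hy : y = 0) (hy' : y' = 3) (hm : m % 2 = 0)

set_option maxHeartbeats 4000000 in
/-- Two segments of the drawing are separated, or equal, or the two crossing links. -/
theorem OddSegment.apart {m x₁ y₁ x₂ y₂ x₃ y₃ x₄ y₄ : ℤ} (hm : 2 ≤ m)
    (h : OddSegment m x₁ y₁ x₂ y₂) (h' : OddSegment m x₃ y₃ x₄ y₄) :
    Apart x₁ y₁ x₂ y₂ x₃ y₃ x₄ y₄ ∨ (x₁ = x₃ ∧ y₁ = y₃ ∧ x₂ = x₄ ∧ y₂ = y₄) ∨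
      (m % 2 = 0 ∧ x₁ = m - 1 ∧ x₂ = m ∧ x₃ = m - 1 ∧ x₄ = m ∧
        y₁ = 0 ∧ y₂ = 3 ∧ y₃ = 3 ∧ y₄ = 0) ∨
      (m % 2 = 0 ∧ x₁ = m - 1 ∧ x₂ = m ∧ x₃ = m - 1 ∧ x₄ = m ∧
        y₁ = 3 ∧ y₂ = 0 ∧ y₃ = 0 ∧ y₄ = 3) := by
  -- Every case tries the separating directions in turn. Where the two families do not determine
  -- the direction, the starting points are compared.
  rcases h <;> rcases h' <;> first
    | exact Or.inl (.inl ⟨by omega, by omega, by omega, by omega, by omega⟩)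
    | exact Or.inl (.inr (.inl ⟨by omega, by omega, by omega, by omega, by omega⟩))
    | exact Or.inl (.inr (.inr (.inl ⟨by omega, by omega, by omega, by omega, by omega⟩)))
    | exact Or.inl (.inr (.inr (.inr (.inl ⟨by omega, by omega, by omega, by omega, by omega⟩))))
    | exact Or.inr (.inl ⟨by omega, by omega, by omega, by omega⟩)
    | exact Or.inr (.inr (.inl ⟨by omega, by omega, by omega, by omega, by omega, by omega,
        by omega, by omega, by omega⟩))
    | exact Or.inr (.inr (.inr ⟨by omega, by omega, by omega, by omega, by omega, by omega,
        by omega, by omega, by omega⟩))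
    | (rcases lt_trichotomy x₁ x₃ with hx | hx | hx <;>
        rcases lt_trichotomy y₁ y₃ with hy | hy | hy <;> first
      | exact Or.inl (.inl ⟨by omega, by omega, by omega, by omega, by omega⟩)
      | exact Or.inl (.inr (.inl ⟨by omega, by omega, by omega, by omega, by omega⟩))
      | exact Or.inl (.inr (.inr (.inl ⟨by omega, by omega, by omega, by omega, by omega⟩)))
      | exact Or.inl (.inr (.inr (.inr (.inl ⟨by omega, by omega, by omega, by omega, by omega⟩))))
      | exact Or.inr (.inl ⟨by omega, by omega, by omega, by omega⟩))

/-- The positions of the vertices in the drawing of `S (2 * m + 1)`: the first `m - 1` columns of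
the ladder, the vertex `1`, and the four vertices of the last block. -/
inductive OddPoint (m x y : ℤ) : Prop
  | grid (h1 : 1 ≤ x) (h2 : x < m) (h3 : 0 ≤ y) (h4 : y ≤ 3)
  | apex (hx : x = 1) (hy : y = 4)
  | lastA (hx : x = m) (hy : y = 3)
  | lastB (hx : x = m + 1) (hy : y = 1)
  | lastC (hx : x = m) (hy : y = -1)
  | lastD (hx : x = m) (hy : y = 0)

/-- No vertex is an interior point of a segment. Endpoints need no exception, since every segment
has different extremal values in one of the separating directions. -/
theorem OddSegment.apart_point {m x₁ y₁ x₂ y₂ x y : ℤ} (hm : 2 ≤ m)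
    (h : OddSegment m x₁ y₁ x₂ y₂) (h' : OddPoint m x y) :
    Apart x₁ y₁ x₂ y₂ x y x y := by
  rcases h <;> rcases h' <;> first
    | exact .inl ⟨by omega, by omega, by omega, by omega, by omega⟩
    | exact .inr (.inl ⟨by omega, by omega, by omega, by omega, by omega⟩)
    | exact .inr (.inr (.inl ⟨by omega, by omega, by omega, by omega, by omega⟩))
    | exact .inr (.inr (.inr (.inl ⟨by omega, by omega, by omega, by omega, by omega⟩)))
    | (rcases lt_trichotomy x x₁ with hx | hx | hx <;>
        rcases lt_trichotomy y y₁ with hy | hy | hy <;> first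
      | exact .inl ⟨by omega, by omega, by omega, by omega, by omega⟩
      | exact .inr (.inl ⟨by omega, by omega, by omega, by omega, by omega⟩)
      | exact .inr (.inr (.inl ⟨by omega, by omega, by omega, by omega, by omega⟩))
      | exact .inr (.inr (.inr (.inl ⟨by omega, by omega, by omega, by omega, by omega⟩))))

/-- The first coordinate of the vertex `n` in the drawing of `S (2 * m + 1)`. -/
def oddX (m n : ℕ) : ℤ := if n = 1 then 1 else if n + 1 = 4 * m then m + 1 else (n + 2) / 4

/-- The second coordinate of the vertex `n` in the drawing of `S (2 * m + 1)`. The odd columns of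
the ladder run downwards and the even ones upwards, except for the last column, the block
`4 * m - 2, …, 4 * m + 1`. -/
def oddY (m n : ℕ) : ℤ :=
  if n = 1 then 4 else if n + 2 = 4 * m then 3 else if n + 1 = 4 * m then 1
  else if n = 4 * m then -1 else if n = 4 * m + 1 then 0
  else if (n + 2) % 8 < 4 then (n + 2) % 4 else 3 - (n + 2) % 4

/-- The pairs `{a, b}` of adjacent vertices of `S (2 * m + 1)`: the path through all vertices in
increasing order, the chords from the first vertex of a block to the last vertex of the next one,
and the two edges from the last block to `1` and `5`. -/
def OddLink (m a b : ℕ) : Prop :=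
  (1 ≤ a ∧ a ≤ 4 * m ∧ b = a + 1) ∨ (a % 4 = 2 ∧ a + 6 ≤ 4 * m ∧ b = a + 7) ∨
    (a = 1 ∧ b + 2 = 4 * m) ∨ (a = 5 ∧ b = 4 * m)

theorem oddPos_inj {m a b : ℕ} (hm : 2 ≤ m) (ha : 1 ≤ a) (ha' : a ≤ 4 * m + 1) (hb : 1 ≤ b)
    (hb' : b ≤ 4 * m + 1) (hx : oddX m a = oddX m b) (hy : oddY m a = oddY m b) : a = b := by
  unfold oddX at hx
  unfold oddY at hy
  omega

theorem oddPoint_oddX_oddY {m n : ℕ} (hm : 2 ≤ m) (hn : 1 ≤ n) (hn' : n ≤ 4 * m + 1) :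
    OddPoint m (oddX m n) (oddY m n) := by
  have : n = 1 ∨ n + 2 = 4 * m ∨ n + 1 = 4 * m ∨ n = 4 * m ∨ n = 4 * m + 1 ∨
    (2 ≤ n ∧ n + 2 < 4 * m) := by omega
  unfold oddX oddY
  rcases this with h | h | h | h | h | h
  · exact .apex (by omega) (by omega)
  · exact .lastA (by omega) (by omega)
  · exact .lastB (by omega) (by omega)
  · exact .lastC (by omega) (by omega)
  · exact .lastD (by omega) (by omega)
  · exact .grid (by omega) (by omega) (by omega) (by omega)

theorem OddLink.segment {m a b : ℕ} (hm : 2 ≤ m) (h : OddLink m a b) :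
    OddSegment m (oddX m a) (oddY m a) (oddX m b) (oddY m b) ∨
      OddSegment m (oddX m b) (oddY m b) (oddX m a) (oddY m a) := by
  rcases h with ⟨h1, h2, rfl⟩ | ⟨h1, h2, rfl⟩ | ⟨rfl, h⟩ | ⟨rfl, rfl⟩
  · have : a = 1 ∨ a + 2 = 4 * m ∨ a + 1 = 4 * m ∨ a = 4 * m ∨ (a + 3 = 4 * m ∧ m % 2 = 1) ∨
      (a + 3 = 4 * m ∧ m % 2 = 0) ∨
      (a + 3 < 4 * m ∧ (a % 8 = 2 ∨ a % 8 = 3 ∨ a % 8 = 4)) ∨ (a + 3 < 4 * m ∧ a % 8 = 5) ∨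
      (a + 3 < 4 * m ∧ (a % 8 = 6 ∨ a % 8 = 7 ∨ a % 8 = 0)) ∨
      (1 < a ∧ a + 3 < 4 * m ∧ a % 8 = 1) := by
      omega
    unfold oddX oddY
    rcases this with h | h | h | h | h | h | h | h | h | h
    · exact .inl (.apexLeft (by omega) (by omega) (by omega) (by omega))
    · exact .inl (.lastOne (by omega) (by omega) (by omega) (by omega))
    · exact .inl (.lastTwo (by omega) (by omega) (by omega) (by omega))
    · exact .inl (.lastThree (by omega) (by omega) (by omega) (by omega))
    · exact .inl (.topLink (by omega) (by omega) (by omega) (by omega) (by omega))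
    · exact .inl (.upLink (by omega) (by omega) (by omega) (by omega) (by omega))
    · exact .inr (.rung (by omega) (by omega) (by omega) (by omega) (by omega) (by omega))
    · exact .inl (.bottomRail (by omega) (by omega) (by omega) (by omega) (by omega))
    · exact .inl (.rung (by omega) (by omega) (by omega) (by omega) (by omega) (by omega))
    · exact .inl (.topRail (by omega) (by omega) (by omega) (by omega) (by omega))
  · have : (a + 6 = 4 * m ∧ m % 2 = 1) ∨ (a + 6 = 4 * m ∧ m % 2 = 0) ∨
      (a + 6 < 4 * m ∧ a % 8 = 2) ∨ (a + 6 < 4 * m ∧ a % 8 = 6) := by omega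
    unfold oddX oddY
    rcases this with h | h | h | h
    · exact .inl (.bottomLink (by omega) (by omega) (by omega) (by omega) (by omega))
    · exact .inl (.downLink (by omega) (by omega) (by omega) (by omega) (by omega))
    · exact .inl (.topRail (by omega) (by omega) (by omega) (by omega) (by omega))
    · exact .inl (.bottomRail (by omega) (by omega) (by omega) (by omega) (by omega))
  · unfold oddX oddY
    exact .inl (.apexRight (by omega) (by omega) (by omega) (by omega))
  · unfold oddX oddY
    exact .inl (.bottom (by omega) (by omega) (by omega) (by omega))

/-! ### The drawing for even `k` -/

/-- The segments of the drawing of `S (2 * m + 2)`, from `(x, y)` to `(x', y')`, each listed in one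
direction: the rungs and rails, with the upper left corner moved to `(0, 3)` if `2 ≤ m` and the
lower right corner moved to `(m, -2)`; the edges from the hub `(0, -2)` to the lower right corner and over
`(m + 1, -3)` to the upper right corner; and the edges from the hub to the two left corners, one of
them over the vertex `1`, according to the parity of `m`. For `m = 1` the lower left corner is the
lower right corner, so the hub has one edge less. -/
inductive EvenSegment (m x y x' y' : ℤ) : Prop
  | midRung (hx : x' = x) (hy : y = 1) (hy' : y' = 2) (h1 : 1 ≤ x) (h2 : x ≤ m)
  | lowRung (hx : x' = x) (hy : y = 0) (hy' : y' = 1) (h1 : 1 ≤ x) (h2 : x < m)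
  | highRung (hx : x' = x) (hy : y = 2) (hy' : y' = 3) (h1 : 2 ≤ x) (h2 : x ≤ m)
  | soleHighRung (hx : x = 1) (hx' : x' = 1) (hy : y = 2) (hy' : y' = 3) (hm : m = 1)
  | firstHighRung (hx : x = 1) (hx' : x' = 0) (hy : y = 2) (hy' : y' = 3) (hm : 2 ≤ m)
  | lastLowRung (hx : x = m) (hx' : x' = m) (hy : y = -2) (hy' : y' = 1)
  | topRail (hx : x' = x + 1) (hy : y = 3) (hy' : y' = 3) (h1 : 2 ≤ x) (h2 : x < m)
  | firstTopRail (hx : x = 0) (hx' : x' = 2) (hy : y = 3) (hy' : y' = 3) (hm : 2 ≤ m)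
  | bottomRail (hx : x' = x + 1) (hy : y = 0) (hy' : y' = 0) (h1 : 1 ≤ x) (h2 : x + 1 < m)
  | lastBottomRail (hx : x = m - 1) (hx' : x' = m) (hy : y = 0) (hy' : y' = -2) (hm : 2 ≤ m)
  | hubBottom (hx : x = 0) (hx' : x' = m) (hy : y = -2) (hy' : y' = -2)
  | hubCorner (hx : x = 0) (hx' : x' = m + 1) (hy : y = -2) (hy' : y' = -3)
  | cornerTop (hx : x = m + 1) (hx' : x' = m) (hy : y = -3) (hy' : y' = 3)
  | oddHubOne (hx : x = 0) (hx' : x' = 0) (hy : y = -2) (hy' : y' = 0) (hm : m % 2 = 1)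
  | oddOneTop (hx : x = 0) (hx' : x' = 0) (hy : y = 0) (hy' : y' = 3) (hm : m % 2 = 1) (hm' : 2 ≤ m)
  | soleOneTop (hx : x = 0) (hx' : x' = 1) (hy : y = 0) (hy' : y' = 3) (hm : m = 1)
  | oddHubFive (hx : x = 0) (hx' : x' = 1) (hy : y = -2) (hy' : y' = 0) (hm : m % 2 = 1)
      (hm' : 2 ≤ m)
  | evenHubFive (hx : x = 0) (hx' : x' = 0) (hy : y = -2) (hy' : y' = 3) (hm : m % 2 = 0)
  | evenHubOne (hx : x = 0) (hx' : x' = 1) (hy : y = -2) (hy' : y' = -1) (hm : m % 2 = 0)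
  | evenOneBottom (hx : x = 1) (hx' : x' = 1) (hy : y = -1) (hy' : y' = 0) (hm : m % 2 = 0)

/-- The positions of the vertices in the drawing of `S (2 * m + 2)`. -/
inductive EvenPoint (m x y : ℤ) : Prop
  | mid (h1 : 1 ≤ x) (h2 : x ≤ m) (h3 : 1 ≤ y) (h4 : y ≤ 2)
  | bottom (h1 : 1 ≤ x) (h2 : x < m) (hy : y = 0)
  | lastBottom (hx : x = m) (hy : y = -2)
  | top (h1 : 2 ≤ x) (h2 : x ≤ m) (hy : y = 3)
  | soleTop (hx : x = 1) (hy : y = 3) (hm : m = 1)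
  | firstTop (hx : x = 0) (hy : y = 3) (hm : 2 ≤ m)
  | hub (hx : x = 0) (hy : y = -2)
  | corner (hx : x = m + 1) (hy : y = -3)
  | oddOne (hx : x = 0) (hy : y = 0) (hm : m % 2 = 1)
  | evenOne (hx : x = 1) (hy : y = -1) (hm : m % 2 = 0)

theorem EvenSegment.apart_point {m x₁ y₁ x₂ y₂ x y : ℤ} (hm : 1 ≤ m)
    (h : EvenSegment m x₁ y₁ x₂ y₂) (h' : EvenPoint m x y) :
    Apart x₁ y₁ x₂ y₂ x y x y := by
  rcases h <;> rcases h' <;> first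
    | exact .inl ⟨by omega, by omega, by omega, by omega, by omega⟩
    | exact .inr (.inl ⟨by omega, by omega, by omega, by omega, by omega⟩)
    | exact .inr (.inr (.inl ⟨by omega, by omega, by omega, by omega, by omega⟩))
    | exact .inr (.inr (.inr (.inl ⟨by omega, by omega, by omega, by omega, by omega⟩)))
    | (rcases lt_trichotomy x x₁ with hx | hx | hx <;>
        rcases lt_trichotomy y y₁ with hy | hy | hy <;> first
      | exact .inl ⟨by omega, by omega, by omega, by omega, by omega⟩
      | exact .inr (.inl ⟨by omega, by omega, by omega, by omega, by omega⟩)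
      | exact .inr (.inr (.inl ⟨by omega, by omega, by omega, by omega, by omega⟩))
      | exact .inr (.inr (.inr (.inl ⟨by omega, by omega, by omega, by omega, by omega⟩))))

set_option maxHeartbeats 4000000 in
/-- Two segments of the drawing are separated or equal. -/
theorem EvenSegment.apart {m x₁ y₁ x₂ y₂ x₃ y₃ x₄ y₄ : ℤ} (hm : 1 ≤ m)
    (h : EvenSegment m x₁ y₁ x₂ y₂) (h' : EvenSegment m x₃ y₃ x₄ y₄) :
    Apart x₁ y₁ x₂ y₂ x₃ y₃ x₄ y₄ ∨ (x₁ = x₃ ∧ y₁ = y₃ ∧ x₂ = x₄ ∧ y₂ = y₄) := by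
  rcases h <;> rcases h' <;> first
    | exact Or.inl (.inl ⟨by omega, by omega, by omega, by omega, by omega⟩)
    | exact Or.inl (.inr (.inl ⟨by omega, by omega, by omega, by omega, by omega⟩))
    | exact Or.inl (.inr (.inr (.inl ⟨by omega, by omega, by omega, by omega, by omega⟩)))
    | exact Or.inl (.inr (.inr (.inr (.inl ⟨by omega, by omega, by omega, by omega, by omega⟩))))
    | exact Or.inl (.inr (.inr (.inr (.inr (.inl
        ⟨by omega, by omega, by omega, by omega, by omega⟩)))))
    | exact Or.inl (.inr (.inr (.inr (.inr (.inr
        ⟨by omega, by omega, by omega, by omega, by omega⟩)))))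
    | exact Or.inr ⟨by omega, by omega, by omega, by omega⟩
    | (rcases lt_trichotomy x₁ x₃ with hx | hx | hx <;> first
      | exact Or.inl (.inl ⟨by omega, by omega, by omega, by omega, by omega⟩)
      | exact Or.inl (.inr (.inl ⟨by omega, by omega, by omega, by omega, by omega⟩))
      | exact Or.inl (.inr (.inr (.inl ⟨by omega, by omega, by omega, by omega, by omega⟩)))
      | exact Or.inl (.inr (.inr (.inr (.inl ⟨by omega, by omega, by omega, by omega, by omega⟩))))
      | exact Or.inr ⟨by omega, by omega, by omega, by omega⟩)

/-- The first coordinate of the vertex `n` in the drawing of `S (2 * m + 2)`. -/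
def evenX (m n : ℕ) : ℤ :=
  if n = 1 then (m + 1) % 2
  else if n = 4 * m + 2 then 0 else if n = 4 * m + 3 then m + 1
  else if 2 ≤ m ∧ (n = 2 ∧ m % 2 = 1 ∨ n = 5 ∧ m % 2 = 0) then 0 else ((n : ℤ) + 2) / 4

/-- The second coordinate of the vertex `n` in the drawing of `S (2 * m + 2)`. The columns of the
ladder run downwards and upwards alternately, the last one downwards. -/
def evenY (m n : ℕ) : ℤ :=
  if n = 1 then m % 2 - 1
  else if n = 4 * m + 1 then -2 else if n = 4 * m + 2 then -2 else if n = 4 * m + 3 then -3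
  else if (n + 2 + 4 * m) % 8 < 4 then 3 - (n + 2) % 4 else (n + 2) % 4

/-- The pairs `{a, b}` of adjacent vertices of `S (2 * m + 2)`: the path through all vertices in
increasing order, the chords from the first vertex of a block to the last vertex of the next one,
the edge from the first vertex of the last block to `4 * m + 3`, and the edges from the hub
`4 * m + 2` to `1` and `5`. -/
def EvenLink (m a b : ℕ) : Prop :=
  (1 ≤ a ∧ a ≤ 4 * m + 2 ∧ b = a + 1) ∨ (a % 4 = 2 ∧ a + 6 ≤ 4 * m ∧ b = a + 7) ∨
    (b = 4 * m + 3 ∧ a + 2 = 4 * m) ∨ (a = 4 * m + 2 ∧ b = 1) ∨ (a = 4 * m + 2 ∧ b = 5)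

set_option maxHeartbeats 1000000 in
theorem evenPos_inj {m a b : ℕ} (hm : 1 ≤ m) (ha : 1 ≤ a) (ha' : a ≤ 4 * m + 3) (hb : 1 ≤ b)
    (hb' : b ≤ 4 * m + 3) (hx : evenX m a = evenX m b) (hy : evenY m a = evenY m b) : a = b := by
  unfold evenX at hx
  unfold evenY at hy
  split_ifs at hx hy <;> omega

theorem evenPoint_evenX_evenY {m n : ℕ} (hm : 1 ≤ m) (hn : 1 ≤ n) (hn' : n ≤ 4 * m + 3) :
    EvenPoint m (evenX m n) (evenY m n) := by
  have hn1 : n = 4 * m + 2 ∨ n = 4 * m + 3 ∨ n = 4 * m + 1 ∨ (n = 1 ∧ m % 2 = 1) ∨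
    (n = 1 ∧ m % 2 = 0) ∨
    (2 ≤ n ∧ n ≤ 4 * m) := by omega
  rcases hn1 with h | h | h | h | h | h
  · unfold evenX evenY
    exact .hub (by omega) (by omega)
  · unfold evenX evenY
    exact .corner (by omega) (by omega)
  · unfold evenX evenY
    exact .lastBottom (by omega) (by omega)
  · unfold evenX evenY
    exact .oddOne (by omega) (by omega) (by omega)
  · unfold evenX evenY
    exact .evenOne (by omega) (by omega) (by omega)
  have hy : evenY m n =
      if (n + 2 + 4 * m) % 8 < 4 then 3 - ((n : ℤ) + 2) % 4 else ((n : ℤ) + 2) % 4 := by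
    unfold evenY; split_ifs <;> omega
  have hx : evenX m n =
      if 2 ≤ m ∧ (n = 2 ∧ m % 2 = 1 ∨ n = 5 ∧ m % 2 = 0) then 0 else ((n : ℤ) + 2) / 4 := by
    unfold evenX; split_ifs <;> omega
  have : (n + 2) % 4 = 1 ∨ (n + 2) % 4 = 2 ∨
    (2 ≤ m ∧ (n = 2 ∧ m % 2 = 1 ∨ n = 5 ∧ m % 2 = 0)) ∨
    (¬(2 ≤ m ∧ (n = 2 ∧ m % 2 = 1 ∨ n = 5 ∧ m % 2 = 0)) ∧
      ((m = 1 ∧ n = 2) ∨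
      (2 ≤ m ∧ ((n + 2 + 4 * m) % 8 = 0 ∨ (n + 2 + 4 * m) % 8 = 7) ∧ 6 ≤ n) ∨
      ((n + 2 + 4 * m) % 8 = 3 ∨ (n + 2 + 4 * m) % 8 = 4))) := by omega
  rcases this with h | h | h | ⟨h', h | h | h⟩
  · rw [hx, hy]
    exact .mid (by omega) (by omega) (by omega) (by omega)
  · rw [hx, hy]
    exact .mid (by omega) (by omega) (by omega) (by omega)
  · rw [hx, hy]
    exact .firstTop (by omega) (by omega) (by omega)
  · rw [hx, hy]
    exact .soleTop (by omega) (by omega) (by omega)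
  · rw [hx, hy]
    exact .top (by omega) (by omega) (by omega)
  · rw [hx, hy]
    exact .bottom (by omega) (by omega) (by omega)

set_option maxHeartbeats 1000000 in
/-- The edges of the path `2, …, 4 * m` are segments of the drawing. The cases are distinguished by
the position in the column and the direction of the column. -/
theorem evenSegment_succ {m a : ℕ} (hm : 1 ≤ m) (h1 : 2 ≤ a) (h2 : a + 1 ≤ 4 * m) :
    EvenSegment m (evenX m a) (evenY m a) (evenX m (a + 1)) (evenY m (a + 1)) ∨
      EvenSegment m (evenX m (a + 1)) (evenY m (a + 1)) (evenX m a) (evenY m a) := by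
  have : (a + 4 * m) % 8 = 7 ∨ (a + 4 * m) % 8 = 3 ∨
    (a = 2 ∧ m % 2 = 1 ∧ 2 ≤ m) ∨ (a = 2 ∧ m = 1) ∨ (a ≠ 2 ∧ (a + 4 * m) % 8 = 6) ∨
    (a + 4 * m) % 8 = 2 ∨ (a + 4 * m) % 8 = 0 ∨
    (a = 4 ∧ m % 2 = 0) ∨ (a ≠ 4 ∧ (a + 4 * m) % 8 = 4) ∨
    (a + 4 * m) % 8 = 1 ∨ (a = 5 ∧ m % 2 = 0) ∨ (a ≠ 5 ∧ (a + 4 * m) % 8 = 5) := by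
    omega
  unfold evenX evenY
  rcases this with h | h | h | h | h | h | h | h | h | h | h | h
  · exact .inr (.midRung (by omega) (by omega) (by omega) (by omega) (by omega))
  · exact .inl (.midRung (by omega) (by omega) (by omega) (by omega) (by omega))
  · exact .inr (.firstHighRung (by omega) (by omega) (by omega) (by omega) (by omega))
  · exact .inr (.soleHighRung (by omega) (by omega) (by omega) (by omega) (by omega))
  · exact .inr (.highRung (by omega) (by omega) (by omega) (by omega) (by omega))
  · exact .inl (.lowRung (by omega) (by omega) (by omega) (by omega) (by omega))
  · exact .inr (.lowRung (by omega) (by omega) (by omega) (by omega) (by omega))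
  · exact .inl (.firstHighRung (by omega) (by omega) (by omega) (by omega) (by omega))
  · exact .inl (.highRung (by omega) (by omega) (by omega) (by omega) (by omega))
  · exact .inl (.bottomRail (by omega) (by omega) (by omega) (by omega) (by omega))
  · exact .inl (.firstTopRail (by omega) (by omega) (by omega) (by omega) (by omega))
  · exact .inl (.topRail (by omega) (by omega) (by omega) (by omega) (by omega))

set_option maxHeartbeats 1000000 in
theorem EvenLink.segment {m a b : ℕ} (hm : 1 ≤ m) (h : EvenLink m a b) :
    EvenSegment m (evenX m a) (evenY m a) (evenX m b) (evenY m b) ∨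
      EvenSegment m (evenX m b) (evenY m b) (evenX m a) (evenY m a) := by
  rcases h with ⟨h1, h2, rfl⟩ | ⟨h1, h2, rfl⟩ | ⟨rfl, h⟩ | ⟨rfl, rfl⟩ | ⟨rfl, rfl⟩
  · have : (a = 1 ∧ m % 2 = 0) ∨ (a = 1 ∧ m % 2 = 1 ∧ 2 ≤ m) ∨ (a = 1 ∧ m = 1) ∨
      a = 4 * m ∨ a = 4 * m + 1 ∨ a = 4 * m + 2 ∨ (2 ≤ a ∧ a + 1 ≤ 4 * m) := by omega
    rcases this with h | h | h | h | h | h | ⟨h1, h2⟩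
    · unfold evenX evenY
      exact .inl (.evenOneBottom (by omega) (by omega) (by omega) (by omega) (by omega))
    · unfold evenX evenY
      exact .inl (.oddOneTop (by omega) (by omega) (by omega) (by omega) (by omega) (by omega))
    · unfold evenX evenY
      exact .inl (.soleOneTop (by omega) (by omega) (by omega) (by omega) (by omega))
    · unfold evenX evenY
      exact .inr (.lastLowRung (by omega) (by omega) (by omega) (by omega))
    · unfold evenX evenY
      exact .inr (.hubBottom (by omega) (by omega) (by omega) (by omega))
    · unfold evenX evenY
      exact .inl (.hubCorner (by omega) (by omega) (by omega) (by omega))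
    · exact evenSegment_succ hm h1 h2
  · have : (a = 2 ∧ 3 ≤ m ∧ m % 2 = 1) ∨ (a + 6 = 4 * m) ∨
      (a + 6 < 4 * m ∧ (a + 4 * m) % 8 = 2) ∨ (a ≠ 2 ∧ a + 6 < 4 * m ∧ (a + 4 * m) % 8 = 6) := by
      omega
    unfold evenX evenY
    rcases this with h | h | h | h
    · exact .inl (.firstTopRail (by omega) (by omega) (by omega) (by omega) (by omega))
    · exact .inl (.lastBottomRail (by omega) (by omega) (by omega) (by omega) (by omega))
    · exact .inl (.bottomRail (by omega) (by omega) (by omega) (by omega) (by omega))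
    · exact .inl (.topRail (by omega) (by omega) (by omega) (by omega) (by omega))
  · unfold evenX evenY
    exact .inr (.cornerTop (by omega) (by omega) (by omega) (by omega))
  · unfold evenX evenY
    rcases Nat.mod_two_eq_zero_or_one m with h | h
    · exact .inl (.evenHubOne (by omega) (by omega) (by omega) (by omega) (by omega))
    · exact .inl (.oddHubOne (by omega) (by omega) (by omega) (by omega) (by omega))
  · unfold evenX evenY
    have : m % 2 = 0 ∨ (m % 2 = 1 ∧ 2 ≤ m) ∨ m = 1 := by omega
    rcases this with h | h | h
    · exact .inl (.evenHubFive (by omega) (by omega) (by omega) (by omega) (by omega))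
    · exact .inl (.oddHubFive (by omega) (by omega) (by omega) (by omega) (by omega) (by omega))
    · exact .inl (.hubBottom (by omega) (by omega) (by omega) (by omega))

/-! ### The drawings of `S k` -/

theorem OddEdge.link {m a b : ℕ} (hm : 2 ≤ m) (h : OddEdge (2 * m + 1) a b) :
    OddLink m a b ∨ OddLink m b a := by
  rcases h with ⟨i, hi, h⟩ | ⟨i, hi, h⟩ | h | h | h
  · rw [Finset.mem_Icc] at hi
    rcases h with (h | h) | (h | h) | h | h
    · exact .inl (.inl (by omega))
    · exact .inr (.inl (by omega))
    · exact .inl (.inl (by omega))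
    · exact .inr (.inl (by omega))
    · exact .inl (.inl (by omega))
    · exact .inr (.inl (by omega))
  · rw [Finset.mem_Icc] at hi
    rcases h with h | h
    · exact .inl (.inr (.inl (by omega)))
    · exact .inl (.inl (by omega))
  · exact .inl (.inl (by omega))
  · exact .inr (.inr (.inr (.inl (by omega))))
  · exact .inr (.inr (.inr (.inr (by omega))))

theorem EvenEdge.link {m a b : ℕ} (hm : 1 ≤ m) (h : EvenEdge (2 * m + 2) a b) :
    EvenLink m a b ∨ EvenLink m b a := by
  rcases h with ⟨i, hi, h⟩ | ⟨i, hi, h⟩ | h | h | h | h | h | h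
  · rw [Finset.mem_Icc] at hi
    rcases h with (h | h) | (h | h) | h | h
    · exact .inl (.inl (by omega))
    · exact .inr (.inl (by omega))
    · exact .inl (.inl (by omega))
    · exact .inr (.inl (by omega))
    · exact .inl (.inl (by omega))
    · exact .inr (.inl (by omega))
  · rw [Finset.mem_Icc] at hi
    rcases h with h | h
    · exact .inl (.inr (.inl (by omega)))
    · exact .inl (.inl (by omega))
  · exact .inl (.inl (by omega))
  · exact .inl (.inr (.inr (.inl (by omega))))
  · exact .inl (.inl (by omega))
  · exact .inl (.inr (.inr (.inr (.inl (by omega)))))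
  · exact .inl (.inr (.inr (.inr (.inr (by omega)))))
  · exact .inr (.inl (by omega))

/-- Every edge of `S (2 * m + 2)` has an orientation that is listed in `EvenSegment`. -/
theorem exists_evenSegment {m : ℕ} (hm : 1 ≤ m)
    (e : Sym2 (Finset.Icc 1 (2 * (2 * m + 2) - 1)))
    (he : e ∈ (S (2 * m + 2)).toSimpleGraphInclusive.edgeSet) :
    ∃ u v, e = s(u, v) ∧ EvenSegment m (evenX m u) (evenY m u) (evenX m v) (evenY m v) := by
  induction e with | _ u v
  have hk : ¬ Odd (2 * m + 2) := by simp [Nat.odd_iff]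
  have hl : EvenLink m u v ∨ EvenLink m v u := by
    have : (S (2 * m + 2)).Adj u v ∨ (S (2 * m + 2)).Adj v u := he.2
    simp only [S, hk, false_and, or_false] at this
    exact this.elim (fun h => h.2.link hm) (fun h => (h.2.link hm).symm)
  rcases hl.imp (EvenLink.segment hm) (EvenLink.segment hm) with (h | h) | (h | h)
  · exact ⟨u, v, rfl, h⟩
  · exact ⟨v, u, Sym2.eq_swap, h⟩
  · exact ⟨v, u, Sym2.eq_swap, h⟩
  · exact ⟨u, v, rfl, h⟩

theorem isPlanar_even {m : ℕ} (hm : 1 ≤ m) : IsPlanar (S (2 * m + 2)).toSimpleGraphInclusive := by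
  have bd (v : Finset.Icc 1 (2 * (2 * m + 2) - 1)) : 1 ≤ (v : ℕ) ∧ (v : ℕ) ≤ 4 * m + 3 := by
    have := Finset.mem_Icc.1 v.2
    omega
  have inj {u v : Finset.Icc 1 (2 * (2 * m + 2) - 1)} (hx : evenX m u = evenX m v)
      (hy : evenY m u = evenY m v) : u = v :=
    Subtype.ext (evenPos_inj hm (bd u).1 (bd u).2 (bd v).1 (bd v).2 hx hy)
  have hinj : Function.Injective
      fun v : Finset.Icc 1 (2 * (2 * m + 2) - 1) => pt (evenX m v) (evenY m v) := fun u v h =>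
    inj (pt_inj.1 h).1 (pt_inj.1 h).2
  refine isPlanar_of_disjoint _ hinj (exists_eq_of_mem_segment hinj fun e he => ?_)
    fun ⟨e, he⟩ ⟨f, hf⟩ hef => ?_
  · obtain ⟨u, v, rfl, h⟩ := exists_evenSegment hm e he
    exact ⟨u, v, rfl, fun w =>
      h.apart_point (mod_cast hm) (evenPoint_evenX_evenY hm (bd w).1 (bd w).2)⟩
  · obtain ⟨u, v, rfl, h⟩ := exists_evenSegment hm e he
    obtain ⟨u', v', rfl, h'⟩ := exists_evenSegment hm f hf
    rcases h.apart (mod_cast hm) h' with h | ⟨h1, h2, h3, h4⟩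
    · exact inter_eq_empty_of_apart h
    · obtain rfl := inj h1 h2
      obtain rfl := inj h3 h4
      exact absurd rfl hef

/-- Every edge of `S (2 * m + 1)` has an orientation that is listed in `OddSegment`. -/
theorem exists_oddSegment {m : ℕ} (hm : 2 ≤ m)
    (e : Sym2 (Finset.Icc 1 (2 * (2 * m + 1) - 1)))
    (he : e ∈ (S (2 * m + 1)).toSimpleGraphInclusive.edgeSet) :
    ∃ u v, e = s(u, v) ∧ OddSegment m (oddX m u) (oddY m u) (oddX m v) (oddY m v) := by
  induction e with | _ u v
  have hk : ¬ Even (2 * m + 1) := by simp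
  have hl : OddLink m u v ∨ OddLink m v u := by
    have : (S (2 * m + 1)).Adj u v ∨ (S (2 * m + 1)).Adj v u := he.2
    simp only [S, hk, false_and, false_or] at this
    exact this.elim (fun h => h.2.link hm) (fun h => (h.2.link hm).symm)
  rcases hl.imp (OddLink.segment hm) (OddLink.segment hm) with (h | h) | (h | h)
  · exact ⟨u, v, rfl, h⟩
  · exact ⟨v, u, Sym2.eq_swap, h⟩
  · exact ⟨v, u, Sym2.eq_swap, h⟩
  · exact ⟨u, v, rfl, h⟩

theorem oddPos_injective {m : ℕ} (hm : 2 ≤ m) {u v : Finset.Icc 1 (2 * (2 * m + 1) - 1)}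
    (hx : oddX m u = oddX m v) (hy : oddY m u = oddY m v) : u = v := by
  have hu := Finset.mem_Icc.1 u.2
  have hv := Finset.mem_Icc.1 v.2
  exact Subtype.ext (oddPos_inj hm hu.1 (by omega) hv.1 (by omega) hx hy)

theorem oddPt_injective {m : ℕ} (hm : 2 ≤ m) : Function.Injective
    fun v : Finset.Icc 1 (2 * (2 * m + 1) - 1) => pt (oddX m v) (oddY m v) := fun _ _ h =>
  oddPos_injective hm (pt_inj.1 h).1 (pt_inj.1 h).2

theorem eq_of_mem_oddSegment {m : ℕ} (hm : 2 ≤ m) (u v w : Finset.Icc 1 (2 * (2 * m + 1) - 1))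
    (huv : (S (2 * m + 1)).toSimpleGraphInclusive.Adj u v)
    (hw : pt (oddX m w) (oddY m w) ∈ segment ℝ (pt (oddX m u) (oddY m u))
      (pt (oddX m v) (oddY m v))) : w = u ∨ w = v := by
  refine exists_eq_of_mem_segment (X := fun v : Finset.Icc 1 (2 * (2 * m + 1) - 1) => oddX m v)
    (Y := fun v => oddY m v)
    (oddPt_injective hm) (fun e he => ?_) u v w huv hw
  obtain ⟨u, v, rfl, h⟩ := exists_oddSegment hm e he
  refine ⟨u, v, rfl, fun w => h.apart_point (mod_cast hm) ?_⟩
  have := Finset.mem_Icc.1 w.2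
  exact oddPoint_oddX_oddY hm this.1 (by omega)

theorem isPlanar_odd {m : ℕ} (hm : 2 ≤ m) (hodd : m % 2 = 1) :
    IsPlanar (S (2 * m + 1)).toSimpleGraphInclusive := by
  refine isPlanar_of_disjoint _ (oddPt_injective hm) (eq_of_mem_oddSegment hm)
    fun ⟨e, he⟩ ⟨f, hf⟩ hef => ?_
  obtain ⟨u, v, rfl, h⟩ := exists_oddSegment hm e he
  obtain ⟨u', v', rfl, h'⟩ := exists_oddSegment hm f hf
  rcases h.apart (mod_cast hm) h' with h | ⟨h1, h2, h3, h4⟩ | h | h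
  · exact inter_eq_empty_of_apart h
  · obtain rfl := oddPos_injective hm h1 h2
    obtain rfl := oddPos_injective hm h3 h4
    exact absurd rfl hef
  · omega
  · omega

theorem exists_drawing_odd {m : ℕ} (hm : 2 ≤ m) (heven : m % 2 = 0) :
    ∃ D : Drawing (S (2 * m + 1)).toSimpleGraphInclusive, D.crossings.encard = 1 := by
  have mem (n : ℕ) (h1 : 1 ≤ n) (h2 : n ≤ 4 * m + 1) : n ∈ Finset.Icc 1 (2 * (2 * m + 1) - 1) :=
    Finset.mem_Icc.2 ⟨h1, by omega⟩
  -- The two edges that cross join the last two columns.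
  let a : Finset.Icc 1 (2 * (2 * m + 1) - 1) := ⟨4 * m - 3, mem _ (by omega) (by omega)⟩
  let b : Finset.Icc 1 (2 * (2 * m + 1) - 1) := ⟨4 * m - 2, mem _ (by omega) (by omega)⟩
  let c : Finset.Icc 1 (2 * (2 * m + 1) - 1) := ⟨4 * m - 6, mem _ (by omega) (by omega)⟩
  let d : Finset.Icc 1 (2 * (2 * m + 1) - 1) := ⟨4 * m + 1, mem _ (by omega) (by omega)⟩
  have hk : Odd (2 * m + 1) := by simp
  have hab : (S (2 * m + 1)).toSimpleGraphInclusive.Adj a b := by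
    refine ⟨fun h => ?_, Or.inl (Or.inr ⟨hk, Or.inr (Or.inl ⟨m - 1, ?_, Or.inr ⟨?_, ?_⟩⟩)⟩)⟩
    · have := congrArg Subtype.val h
      simp only [a, b] at this
      omega
    · rw [Finset.mem_Icc]
      omega
    · simp only [a]
      omega
    · simp only [b]
      omega
  have hcd : (S (2 * m + 1)).toSimpleGraphInclusive.Adj c d := by
    refine ⟨fun h => ?_, Or.inl (Or.inr ⟨hk, Or.inr (Or.inl ⟨m - 1, ?_, Or.inl ⟨?_, ?_⟩⟩)⟩)⟩
    · have := congrArg Subtype.val h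
      simp only [c, d] at this
      omega
    · rw [Finset.mem_Icc]
      omega
    · simp only [c]
      omega
    · simp only [d]
      omega
  have hax : oddX m a = m - 1 := by simp only [a, oddX]; omega
  have hay : oddY m a = 0 := by simp only [a, oddY]; omega
  have hbx : oddX m b = m := by simp only [b, oddX]; omega
  have hby : oddY m b = 3 := by simp only [b, oddY]; omega
  have hcx : oddX m c = m - 1 := by simp only [c, oddX]; omega
  have hcy : oddY m c = 3 := by simp only [c, oddY]; omega
  have hdx : oddX m d = m := by simp only [d, oddX]; omega
  have hdy : oddY m d = 0 := by simp only [d, oddY]; split_ifs <;> omega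
  have hne : (⟨s(a, b), hab⟩ : (S (2 * m + 1)).toSimpleGraphInclusive.edgeSet) ≠
      ⟨s(c, d), hcd⟩ := by
    intro h
    have hac : a ≠ c := fun h => by rw [h] at hay; omega
    have had : a ≠ d := fun h => by rw [h] at hax; omega
    rcases Sym2.eq_iff.1 (congrArg Subtype.val h) with h | h
    · exact hac h.1
    · exact had h.1
  have hs : segment ℝ (pt (oddX m a) (oddY m a)) (pt (oddX m b) (oddY m b)) =
      segment ℝ ((m : ℝ) - 1, 0) ((m : ℝ) - 1 + 1, 3) := by
    simp [hax, hay, hbx, hby, pt]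
  have hs' : segment ℝ (pt (oddX m c) (oddY m c)) (pt (oddX m d) (oddY m d)) =
      segment ℝ ((m : ℝ) - 1, 3) ((m : ℝ) - 1 + 1, 0) := by
    simp [hcx, hcy, hdx, hdy, pt]
  refine exists_drawing_encard_crossings_eq_one _ (oddPt_injective hm) (eq_of_mem_oddSegment hm)
    (p₀ := ((m : ℝ) - 1 + 1 / 2, 3 / 2)) hne (fun ⟨e, he⟩ ⟨f, hf⟩ hef => ?_) ?_ ?_
  · obtain ⟨u, v, rfl, h⟩ := exists_oddSegment hm e he
    obtain ⟨u', v', rfl, h'⟩ := exists_oddSegment hm f hf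
    rcases h.apart (mod_cast hm) h' with h | ⟨h1, h2, h3, h4⟩ |
      ⟨-, h1, h2, h3, h4, h5, h6, h7, h8⟩ | ⟨-, h1, h2, h3, h4, h5, h6, h7, h8⟩
    · exact .inr (.inr (inter_eq_empty_of_apart h))
    · obtain rfl := oddPos_injective hm h1 h2
      obtain rfl := oddPos_injective hm h3 h4
      exact absurd rfl hef
    · obtain rfl : u = a := oddPos_injective hm (h1.trans hax.symm) (h5.trans hay.symm)
      obtain rfl : v = b := oddPos_injective hm (h2.trans hbx.symm) (h6.trans hby.symm)
      obtain rfl : u' = c := oddPos_injective hm (h3.trans hcx.symm) (h7.trans hcy.symm)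
      obtain rfl : v' = d := oddPos_injective hm (h4.trans hdx.symm) (h8.trans hdy.symm)
      exact .inl ⟨rfl, rfl⟩
    · obtain rfl : u = c := oddPos_injective hm (h1.trans hcx.symm) (h5.trans hcy.symm)
      obtain rfl : v = d := oddPos_injective hm (h2.trans hdx.symm) (h6.trans hdy.symm)
      obtain rfl : u' = a := oddPos_injective hm (h3.trans hax.symm) (h7.trans hay.symm)
      obtain rfl : v' = b := oddPos_injective hm (h4.trans hbx.symm) (h8.trans hby.symm)
      exact .inr (.inl ⟨rfl, rfl⟩)
  · simp only [edgeSegment_mk, hs, hs']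
    refine Set.Subset.antisymm (fun q hq => eq_of_mem_diagonals hq.1.1 hq.2.1) ?_
    rintro _ rfl
    have hn : ((m : ℝ) - 1 + 1 / 2, (3 / 2 : ℝ)) ∉ Set.range
        fun v : Finset.Icc 1 (2 * (2 * m + 1) - 1) => pt (oddX m v) (oddY m v) := by
      -- The vertices have integer coordinates.
      rintro ⟨v, hv⟩
      have h2 : (oddY m v : ℝ) = 3 / 2 := congrArg Prod.snd hv
      have : 2 * oddY m v = 3 := by
        have : (2 : ℝ) * oddY m v = 3 := by linarith
        exact_mod_cast this
      omega
    exact ⟨⟨(center_mem_diagonals _).1, hn⟩, (center_mem_diagonals _).2, hn⟩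
  · simp only [edgeSegment_mk, hs, hs']
    exact crossAt_diagonals _

end InOutGraph

theorem proposition3 (k : ℕ) (hk : 4 ≤ k) :
    (¬ k ≡ 1 [MOD 4] → InOutGraph.IsPlanar (InOutGraph.S k).toSimpleGraphInclusive) ∧
    (k ≡ 1 [MOD 4] →
      ∃ D : InOutGraph.Drawing (InOutGraph.S k).toSimpleGraphInclusive,
        D.crossings.encard = 1) := by
  have hmod : k ≡ 1 [MOD 4] ↔ k % 4 = 1 := Iff.rfl
  rw [hmod]
  rcases Nat.even_or_odd' k with ⟨n, rfl | rfl⟩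
  · obtain ⟨m, rfl⟩ : ∃ m, n = m + 1 := ⟨n - 1, by omega⟩
    exact ⟨fun _ => InOutGraph.isPlanar_even (by omega), fun h => by omega⟩
  · exact ⟨fun h => InOutGraph.isPlanar_odd (by omega) (by omega),
      fun h => InOutGraph.exists_drawing_odd (by omega) (by omega)⟩
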